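/- Let $\Sigma=\{0,1\}$. A finite word $w$ over $\Sigma$ is called an abelian square if there exist (possibly empty) words $s$ and $t$ such that $w=st$ and $t$ is a permutation of $s$, that is, a rearrangement of the letters of $s$. Let $L\subseteq\Sigma^*$ be the language of all words over $\Sigma$ that are not abelian squares. Then $L$ is not context-free, i.e. $L$ is not generated by any context-free grammar. -/

import Mathlib

/-- A word `w` is an abelian square if `w = st` for some words `s` and `t` such that `t` is a
permutation of `s`. -/
def IsAbelianSquare {α : Type*} (w : List α) : Prop :=
  ∃ s t : List α, w = s ++ t ∧ t.Perm s

/-- The language of all words over the binary alphabet `{0, 1}` that are not abelian squares. -/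
def nonAbelianSquares : Language (Fin 2) :=
  {w : List (Fin 2) | ¬ IsAbelianSquare w}

/-!
The proof pumps the word `0ᵖ1ᵖ⁺ᴺ0ᵖ⁺ᴺ1ᵖ` with `N = 2 * p!`, which is not an abelian square: its
middle lies between the second and the third block, and its halves contain `p` and `p + N` zeros.

Suppose that two nested nodes of a parse tree of this word carry the same nonterminal, so that the
factors `v` and `y` generated between them can be repeated, and that each of the two is a power of a
single letter inside a single block. If `v` or `y` meets the first or the fourth block, then either
`v` lies in the first block and `y` in the third, or `v` lies in the second and `y` in the fourth.
Otherwise some number of repetitions makes the first block as long as the third, while the second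
stays at least as long as the fourth, or makes the fourth as long as the second, while the third
stays at least as long as the first; both give abelian squares
(`exists_isAbelianSquare_fourBlocks`, `mem_of_pump_nonAbelianSquares`).

If `p` is large, an argument in the manner of Ogden's lemma, with the letters of the first block
marked, yields a pair of nodes with `v` or `y` in the first block; marking the fourth block instead
yields, in the same parse tree, a pair with `v` or `y` in the fourth block
(`ContextFreeGrammar.IsNodeSet.exists_pump`). By the above, the outer node of the former pair spans
a factor from the first to the third block, and that of the latter a factor from the second to the
fourth. These factors cross, but factors spanned by nodes of one parse tree are nested or disjoint.

The blocks are kept apart by parsing words over `Fin 4`, whose letters are the numbers of the blocks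
and stand for terminals through `blockLetter`.
-/

open List

namespace ContextFreeGrammar

variable {T D : Type*} (g : ContextFreeGrammar T) (π : D → T)

/-! ### Parse forests of decorated words -/

/-- The sentential form spelled by a decorated word: decorations are forgotten and every letter is
read as a terminal. -/
def sent (w : List D) : List (Symbol T g.NT) := w.map fun d => Symbol.terminal (π d)

/-- `g.Parses π s w` says that the sentential form `s` is the list of roots of a forest of parse
trees whose leaves, read from left to right, are the letters of `w`. A leaf carries a decorated
letter `d : D`, which stands for the terminal `π d`. -/
inductive Parses : List (Symbol T g.NT) → List D → Prop
  | nil : Parses [] []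
  | terminal (d : D) {s : List (Symbol T g.NT)} {w : List D} :
      Parses s w → Parses (Symbol.terminal (π d) :: s) (d :: w)
  | node (r : ContextFreeRule T g.NT) (hr : r ∈ g.rules) {s : List (Symbol T g.NT)}
      {u w : List D} : Parses r.output u → Parses s w →
      Parses (Symbol.nonterminal r.input :: s) (u ++ w)

variable {g π}

lemma sent_append (u v : List D) : g.sent π (u ++ v) = g.sent π u ++ g.sent π v :=
  List.map_append

lemma Parses.append {s s' : List (Symbol T g.NT)} {w w' : List D} (h : g.Parses π s w)
    (h' : g.Parses π s' w') : g.Parses π (s ++ s') (w ++ w') := by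
  induction h with
  | nil => exact h'
  | terminal d _ ih => exact .terminal d ih
  | node r hr hu _ _ ih =>
    rw [List.append_assoc]
    exact .node r hr hu ih

lemma Parses.exists_of_append {s s' : List (Symbol T g.NT)} {w : List D}
    (h : g.Parses π (s ++ s') w) :
    ∃ u v, w = u ++ v ∧ g.Parses π s u ∧ g.Parses π s' v := by
  induction s generalizing w with
  | nil => exact ⟨[], w, rfl, .nil, h⟩
  | cons X s ih =>
    rw [List.cons_append] at h
    cases h with
    | terminal d h =>
      obtain ⟨u, v, rfl, hu, hv⟩ := ih h
      exact ⟨d :: u, v, rfl, .terminal d hu, hv⟩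
    | node r hr h₁ h =>
      obtain ⟨u, v, rfl, hu, hv⟩ := ih h
      exact ⟨_ ++ u, v, (List.append_assoc ..).symm, .node r hr h₁ hu, hv⟩

lemma parses_sent (w : List D) : g.Parses π (g.sent π w) w := by
  induction w with
  | nil => exact .nil
  | cons d w ih => exact .terminal d ih

lemma Parses.of_produces {s s' : List (Symbol T g.NT)} {w : List D} (h : g.Produces s s')
    (hs' : g.Parses π s' w) : g.Parses π s w := by
  obtain ⟨r, hr, hrw⟩ := h
  obtain ⟨p, q, rfl, rfl⟩ := hrw.exists_parts
  obtain ⟨w₁, w₃, rfl, h₁, h₃⟩ := hs'.exists_of_append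
  obtain ⟨w₁, w₂, rfl, h₁, h₂⟩ := h₁.exists_of_append
  rw [List.append_assoc, List.append_assoc]
  exact h₁.append (.node r hr h₂ h₃)

lemma Parses.of_derives {s : List (Symbol T g.NT)} {w : List D}
    (h : g.Derives s (g.sent π w)) : g.Parses π s w := by
  induction h using Relation.ReflTransGen.head_induction_on with
  | refl => exact parses_sent w
  | head h _ ih => exact ih.of_produces h

lemma Derives.append {s s' t t' : List (Symbol T g.NT)} (h : g.Derives s t)
    (h' : g.Derives s' t') : g.Derives (s ++ s') (t ++ t') :=
  (h.append_right s').trans (h'.append_left t)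

lemma derives_output {r : ContextFreeRule T g.NT} (hr : r ∈ g.rules) :
    g.Derives [.nonterminal r.input] r.output :=
  Produces.single ⟨r, hr, ContextFreeRule.Rewrites.input_output⟩

lemma Parses.derives {s : List (Symbol T g.NT)} {w : List D} (h : g.Parses π s w) :
    g.Derives s (g.sent π w) := by
  induction h with
  | nil => exact Derives.refl _
  | terminal d _ ih => exact ih.append_left [_]
  | node r hr _ _ ihu ihw =>
    rw [sent_append]
    exact ((derives_output hr).trans ihu).append ihw

/-! ### Inner nodes of a parse forest -/

variable (g D) in
/-- An occurrence of an inner node in a parse tree of the word `left ++ mid ++ right`: the node is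
labelled `label`, and the leaves below it spell the factor `mid`. -/
structure Occurrence where
  label : g.NT
  left : List D
  mid : List D
  right : List D

variable (π) in
/-- The occurrence `o'` lies inside `o`, and the part of the parse tree between the two is a
derivation of `v o'.label y` from `o.label`. -/
def Occurrence.Below (o o' : g.Occurrence D) : Prop :=
  ∃ v y, o'.left = o.left ++ v ∧ o'.right = y ++ o.right ∧ o.mid = v ++ o'.mid ++ y ∧
    g.Derives [.nonterminal o.label]
      (g.sent π v ++ [.nonterminal o'.label] ++ g.sent π y)

lemma Occurrence.Below.trans {o₁ o₂ o₃ : g.Occurrence D} (h : o₁.Below π o₂)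
    (h' : o₂.Below π o₃) : o₁.Below π o₃ := by
  obtain ⟨v, y, hl, hr, hm, hd⟩ := h
  obtain ⟨v', y', hl', hr', hm', hd'⟩ := h'
  refine ⟨v ++ v', y' ++ y, by simp [hl, hl'], by simp [hr, hr'], by simp [hm, hm'], ?_⟩
  have := hd.trans ((hd'.append_left (g.sent π v)).append_right (g.sent π y))
  simpa [sent_append] using this

variable (π) in
/-- What is needed of the set `S` of inner nodes of a forest of parse trees with roots `s` and leaf
word `w`, where `B` bounds the length of the right-hand sides of the rules. The field `not_crossing`
says that if `o'` starts and ends strictly to the right of the start and the end of `o`, then `o'`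
starts no earlier than `o` ends. The last two fields say, for every marking `q` of letters, that a
word with many marked letters has an inner node with many of them, and that every node with many
marked letters has a node below it which still has many, but strictly fewer. -/
structure IsNodeSet (B : ℕ) (s : List (Symbol T g.NT)) (w : List D)
    (S : Set (g.Occurrence D)) : Prop where
  word_eq : ∀ o ∈ S, o.left ++ o.mid ++ o.right = w
  label_mem : ∀ o ∈ S, ∃ r ∈ g.rules, r.input = o.label
  derives_context : ∀ o ∈ S,
    g.Derives s (g.sent π o.left ++ [.nonterminal o.label] ++ g.sent π o.right)
  derives_mid : ∀ o ∈ S, g.Derives [.nonterminal o.label] (g.sent π o.mid)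
  not_crossing : ∀ o ∈ S, ∀ o' ∈ S, o.left.length < o'.left.length →
    o'.right.length < o.right.length → w.length ≤ o'.left.length + o.right.length
  exists_heavy : ∀ (q : D → Bool) (K : ℕ), 1 ≤ K → s.length * K < w.countP q →
    ∃ o ∈ S, K < o.mid.countP q
  exists_below : ∀ (q : D → Bool) (K : ℕ), 1 ≤ K → ∀ o ∈ S, B * K < o.mid.countP q →
    ∃ o' ∈ S, o.Below π o' ∧ K < o'.mid.countP q ∧ o'.mid.countP q < o.mid.countP q

/-- Moves an occurrence into a larger word, with `u` added on the left and `w` on the right. -/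
def Occurrence.shift (u w : List D) (o : g.Occurrence D) : g.Occurrence D :=
  ⟨o.label, u ++ o.left, o.mid, o.right ++ w⟩

lemma Occurrence.Below.shift {o o' : g.Occurrence D} (h : o.Below π o') (u w : List D) :
    (o.shift u w).Below π (o'.shift u w) := by
  obtain ⟨v, y, hl, hr, hm, hd⟩ := h
  exact ⟨v, y, by simp [Occurrence.shift, hl], by simp [Occurrence.shift, hr], hm, hd⟩

lemma IsNodeSet.cons_terminal {B : ℕ} {s : List (Symbol T g.NT)} {w : List D}
    {S : Set (g.Occurrence D)} (h : IsNodeSet π B s w S) (d : D) :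
    IsNodeSet π B (.terminal (π d) :: s) (d :: w) (Occurrence.shift [d] [] '' S) where
  word_eq := by
    rintro _ ⟨o, ho, rfl⟩
    simp [Occurrence.shift, ← h.word_eq o ho]
  label_mem := by
    rintro _ ⟨o, ho, rfl⟩
    exact h.label_mem o ho
  derives_context := by
    rintro _ ⟨o, ho, rfl⟩
    simpa [Occurrence.shift, sent] using (h.derives_context o ho).append_left [.terminal (π d)]
  derives_mid := by
    rintro _ ⟨o, ho, rfl⟩
    exact h.derives_mid o ho
  not_crossing := by
    rintro _ ⟨o, ho, rfl⟩ _ ⟨o', ho', rfl⟩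
    have := h.not_crossing o ho o' ho'
    simp only [Occurrence.shift, length_append, length_cons, length_nil]
    omega
  exists_heavy := by
    intro q K hK hw
    have h1 : (d :: w).countP q ≤ w.countP q + 1 := by
      rw [List.countP_cons]
      split <;> omega
    rw [List.length_cons, add_mul] at hw
    obtain ⟨o, ho, hq⟩ := h.exists_heavy q K hK (by omega)
    exact ⟨_, ⟨o, ho, rfl⟩, hq⟩
  exists_below := by
    rintro q K hK _ ⟨o, ho, rfl⟩ hq
    obtain ⟨o', ho', hb, hq'⟩ := h.exists_below q K hK o ho hq
    exact ⟨_, ⟨o', ho', rfl⟩, hb.shift _ _, hq'⟩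

lemma IsNodeSet.cons_node {B : ℕ} {s : List (Symbol T g.NT)} {u w : List D}
    {S S' : Set (g.Occurrence D)} {r : ContextFreeRule T g.NT} (hr : r ∈ g.rules)
    (hB : r.output.length ≤ B) (hu : g.Parses π r.output u) (hs : g.Parses π s w)
    (h : IsNodeSet π B r.output u S) (h' : IsNodeSet π B s w S') :
    IsNodeSet π B (.nonterminal r.input :: s) (u ++ w)
      ({⟨r.input, [], u, w⟩} ∪ (Occurrence.shift [] w '' S ∪ Occurrence.shift u [] '' S')) where
  word_eq := by
    rintro _ (rfl | ⟨o, ho, rfl⟩ | ⟨o, ho, rfl⟩)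
    · simp
    · simp [Occurrence.shift, ← h.word_eq o ho]
    · simp [Occurrence.shift, ← h'.word_eq o ho]
  label_mem := by
    rintro _ (rfl | ⟨o, ho, rfl⟩ | ⟨o, ho, rfl⟩)
    · exact ⟨r, hr, rfl⟩
    · exact h.label_mem o ho
    · exact h'.label_mem o ho
  derives_context := by
    rintro _ (rfl | ⟨o, ho, rfl⟩ | ⟨o, ho, rfl⟩)
    · exact hs.derives.append_left [_]
    · have := ((derives_output hr).trans (h.derives_context o ho)).append hs.derives
      simpa [Occurrence.shift, sent_append] using this
    · have := ((derives_output hr).trans hu.derives).append (h'.derives_context o ho)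
      simpa [Occurrence.shift, sent_append] using this
  derives_mid := by
    rintro _ (rfl | ⟨o, ho, rfl⟩ | ⟨o, ho, rfl⟩)
    · exact (derives_output hr).trans hu.derives
    · exact h.derives_mid o ho
    · exact h'.derives_mid o ho
  not_crossing := by
    have hlen : ∀ o ∈ S, o.left.length + o.mid.length + o.right.length = u.length := fun o ho => by
      simp [← h.word_eq o ho]; omega
    have hlen' : ∀ o ∈ S', o.left.length + o.mid.length + o.right.length = w.length :=
      fun o ho => by simp [← h'.word_eq o ho]; omega
    rintro _ (rfl | ⟨o, ho, rfl⟩ | ⟨o, ho, rfl⟩) _ (rfl | ⟨o', ho', rfl⟩ | ⟨o', ho', rfl⟩) <;>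
      simp only [Occurrence.shift, length_append, length_nil]
    · omega
    · omega
    · omega
    · omega
    · have := h.not_crossing o ho o' ho'
      omega
    · omega
    · omega
    · have := hlen o' ho'
      omega
    · have := h'.not_crossing o ho o' ho'
      omega
  exists_heavy := by
    intro q K hK hw
    rw [List.countP_append, List.length_cons, add_mul] at hw
    rcases lt_or_ge K (u.countP q) with hq | hq
    · exact ⟨_, .inl rfl, hq⟩
    · obtain ⟨o, ho, hq'⟩ := h'.exists_heavy q K hK (by omega)
      exact ⟨_, .inr (.inr ⟨o, ho, rfl⟩), hq'⟩
  exists_below := by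
    rintro q K hK _ (rfl | ⟨o, ho, rfl⟩ | ⟨o, ho, rfl⟩) hq
    · have key : ∃ o ∈ S, K < o.mid.countP q ∧ o.mid.countP q < u.countP q := by
        obtain ⟨o, ho, hK'⟩ := h.exists_heavy q K hK
          (lt_of_le_of_lt (Nat.mul_le_mul_right K hB) hq)
        have hle : o.mid.countP q ≤ u.countP q := by
          rw [← h.word_eq o ho, List.countP_append, List.countP_append]
          omega
        rcases hle.lt_or_eq with hlt | heq
        · exact ⟨o, ho, hK', hlt⟩
        -- A node carrying all marked letters is as heavy as the root: the search goes on below it.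
        · obtain ⟨o', ho', -, hq'⟩ := h.exists_below q K hK o ho (heq ▸ hq)
          exact ⟨o', ho', hq'.1, heq ▸ hq'.2⟩
      obtain ⟨o, ho, hq'⟩ := key
      refine ⟨_, .inr (.inl ⟨o, ho, rfl⟩), ⟨o.left, o.right, rfl, rfl, ?_, ?_⟩, hq'⟩
      · exact (h.word_eq o ho).symm
      · exact (derives_output hr).trans (h.derives_context o ho)
    · obtain ⟨o', ho', hb, hq'⟩ := h.exists_below q K hK o ho hq
      exact ⟨_, .inr (.inl ⟨o', ho', rfl⟩), hb.shift _ _, hq'⟩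
    · obtain ⟨o', ho', hb, hq'⟩ := h'.exists_below q K hK o ho hq
      exact ⟨_, .inr (.inr ⟨o', ho', rfl⟩), hb.shift _ _, hq'⟩

lemma Parses.exists_isNodeSet {B : ℕ} (hB : ∀ r ∈ g.rules, r.output.length ≤ B)
    {s : List (Symbol T g.NT)} {w : List D} (h : g.Parses π s w) :
    ∃ S, IsNodeSet π B s w S := by
  induction h with
  | nil => exact ⟨∅, by constructor <;> simp⟩
  | terminal d _ ih =>
    obtain ⟨S, hS⟩ := ih
    exact ⟨_, hS.cons_terminal d⟩
  | node r hr hu hs ihu ihs =>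
    obtain ⟨S, hS⟩ := ihu
    obtain ⟨S', hS'⟩ := ihs
    exact ⟨_, hS.cons_node hr (hB r hr) hu hs hS'⟩

/-! ### Pumping with marked letters -/

/-- Below a node with more than `B ^ n` marked letters there is a chain of `n` further nodes along
which the number of marked letters strictly decreases. -/
lemma IsNodeSet.exists_chain {B : ℕ} (hB : 1 ≤ B) {s : List (Symbol T g.NT)} {w : List D}
    {S : Set (g.Occurrence D)} (h : IsNodeSet π B s w S) (q : D → Bool) (n : ℕ) :
    ∀ o ∈ S, B ^ n < o.mid.countP q → ∃ c : List (g.Occurrence D), c.length = n ∧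
      (∀ o' ∈ c, o' ∈ S) ∧ (o :: c).Pairwise fun a b =>
        a.Below π b ∧ b.mid.countP q < a.mid.countP q := by
  induction n with
  | zero => exact fun o _ _ => ⟨[], rfl, by simp, by simp⟩
  | succ n ih =>
    intro o ho hq
    obtain ⟨o', ho', hb, hq', hlt⟩ := h.exists_below q (B ^ n) (Nat.one_le_pow _ _ hB) o ho
      (by rwa [← pow_succ'])
    obtain ⟨c, hc, hcS, hp⟩ := ih o' ho' hq'
    refine ⟨o' :: c, by simp [hc], by simpa [ho'] using hcS, List.pairwise_cons.2 ⟨?_, hp⟩⟩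
    intro a ha
    rcases List.mem_cons.1 ha with rfl | ha
    · exact ⟨hb, hlt⟩
    · have := List.rel_of_pairwise_cons hp ha
      exact ⟨hb.trans this.1, this.2.trans hlt⟩

/-- A pumping lemma for marked letters: if `w` has enough of them, then some two nested nodes of
the parse tree have the same label and agree under an arbitrary further colouring `κ` by finitely
many colours, while marked letters get lost between the two. -/
lemma IsNodeSet.exists_pump {B : ℕ} (hB : 1 ≤ B) {A : g.NT} {w : List D}
    {S : Set (g.Occurrence D)} (h : IsNodeSet π B [.nonterminal A] w S) {C : Type*} [Fintype C]
    (κ : g.Occurrence D → C) (q : D → Bool)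
    (hw : B ^ (g.rules.card * Fintype.card C) < w.countP q) :
    ∃ o ∈ S, ∃ o' ∈ S, o.Below π o' ∧ o'.mid.countP q < o.mid.countP q ∧
      o.label = o'.label ∧ κ o = κ o' := by
  classical
  by_contra! hcon
  set n := g.rules.card * Fintype.card C
  obtain ⟨o, ho, hq⟩ := h.exists_heavy q (B ^ n) (Nat.one_le_pow _ _ hB) (by simpa using hw)
  obtain ⟨c, hc, hcS, hp⟩ := h.exists_chain hB q n o ho hq
  have hmem : ∀ a ∈ o :: c, a ∈ S := by simpa [ho] using hcS
  have hnd : ((o :: c).map fun a => (a.label, κ a)).Nodup := by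
    refine List.pairwise_map.2 (hp.imp_of_mem ?_)
    intro a b ha hb hab heq
    exact hcon a (hmem a ha) b (hmem b hb) hab.1 hab.2 (congrArg Prod.fst heq)
      (congrArg Prod.snd heq)
  have hsub : ((o :: c).map fun a => (a.label, κ a)).toFinset ⊆
      (g.rules.image ContextFreeRule.input) ×ˢ (Finset.univ : Finset C) := by
    intro x hx
    obtain ⟨a, ha, rfl⟩ := List.mem_map.1 (List.mem_toFinset.1 hx)
    obtain ⟨r, hr, hra⟩ := h.label_mem a (hmem a ha)
    exact Finset.mem_product.2 ⟨Finset.mem_image.2 ⟨r, hr, hra⟩, Finset.mem_univ _⟩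
  have hcard := Finset.card_le_card hsub
  rw [List.toFinset_card_of_nodup hnd, Finset.card_product, Finset.card_univ, List.length_map,
    List.length_cons, hc] at hcard
  have := Nat.mul_le_mul_right (Fintype.card C)
    (Finset.card_image_le (s := g.rules) (f := ContextFreeRule.input))
  omega

lemma derives_iterate {A : g.NT} {v x y : List D}
    (h : g.Derives [.nonterminal A] (g.sent π v ++ [.nonterminal A] ++ g.sent π y))
    (hx : g.Derives [.nonterminal A] (g.sent π x)) (m : ℕ) :
    g.Derives [.nonterminal A]
      (g.sent π ((replicate m v).flatten ++ x ++ (replicate m y).flatten)) := by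
  induction m with
  | zero => simpa using hx
  | succ m ih =>
    have := h.trans ((ih.append_left (g.sent π v)).append_right (g.sent π y))
    have e : (replicate (m + 1) v).flatten ++ x ++ (replicate (m + 1) y).flatten =
        v ++ ((replicate m v).flatten ++ x ++ (replicate m y).flatten) ++ y := by
      rw [replicate_succ, replicate_succ']
      simp
    rw [e, sent_append, sent_append]
    exact this

lemma IsNodeSet.pump_mem_language {B : ℕ} {w : List D} {S : Set (g.Occurrence D)}
    (h : IsNodeSet π B [.nonterminal g.initial] w S) {o o' : g.Occurrence D} (ho : o ∈ S)
    (ho' : o' ∈ S) (hlabel : o.label = o'.label) {v y : List D}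
    (hd : g.Derives [.nonterminal o.label]
      (g.sent π v ++ [.nonterminal o'.label] ++ g.sent π y)) (m : ℕ) :
    (o.left ++ (replicate m v).flatten ++ o'.mid ++ (replicate m y).flatten ++ o.right).map π ∈
      g.language := by
  have h₁ := h.derives_context o ho
  have h₂ := derives_iterate (hlabel ▸ hd) (h.derives_mid o' ho') m
  rw [hlabel] at h₁
  have := h₁.trans ((h₂.append_left (g.sent π o.left)).append_right (g.sent π o.right))
  rw [mem_language_iff, List.map_map]
  rw [← sent_append, ← sent_append] at this
  simpa [sent, Function.comp_def] using this

end ContextFreeGrammar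

/-! ### Sorted words -/

section Sorted

variable {α : Type*} [LinearOrder α]

/-- In a sorted word, a factor that ends with the letter preceding it is a power of that letter. -/
lemma eq_of_getLast?_eq {l v : List α} (h : (l ++ v).Pairwise (· ≤ ·))
    (hlast : l.getLast? = (l ++ v).getLast?) : ∀ a ∈ v, ∀ b ∈ v, a = b := by
  rcases List.eq_nil_or_concat' v with rfl | ⟨v, c, rfl⟩
  · simp
  have hc : c ∈ l := by
    rw [← List.append_assoc, List.getLast?_concat] at hlast
    exact List.mem_of_getLast? hlast
  have key : ∀ a ∈ v ++ [c], a = c := by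
    intro a ha
    refine le_antisymm ?_ ((List.pairwise_append.1 h).2.2 c hc a ha)
    rcases List.mem_append.1 ha with ha | ha
    · exact (List.pairwise_append.1 (List.pairwise_append.1 h).2.1).2.2 a ha c (by simp)
    · exact (List.mem_singleton.1 ha).le
  exact fun a ha b hb => (key a ha).trans (key b hb).symm

/-- In a sorted word, a factor that starts with the letter following it is a power of that
letter. -/
lemma eq_of_head?_eq {y r : List α} (h : (y ++ r).Pairwise (· ≤ ·))
    (hhead : r.head? = (y ++ r).head?) : ∀ a ∈ y, ∀ b ∈ y, a = b := by
  cases y with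
  | nil => simp
  | cons c y =>
    have hc : c ∈ r := List.mem_of_head? (by simpa using hhead)
    have key : ∀ a ∈ c :: y, a = c := by
      intro a ha
      refine le_antisymm ((List.pairwise_append.1 h).2.2 a ha c hc) ?_
      rcases List.mem_cons.1 ha with rfl | ha
      · exact le_rfl
      · exact List.rel_of_pairwise_cons h (List.mem_append_left _ ha)
    exact fun a ha b hb => (key a ha).trans (key b hb).symm

lemma pairwise_le_repeat {l v r : List α} (h : (l ++ v ++ r).Pairwise (· ≤ ·))
    (hv : ∀ a ∈ v, ∀ b ∈ v, a = b) (m : ℕ) :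
    (l ++ (replicate (m + 1) v).flatten ++ r).Pairwise (· ≤ ·) := by
  have hmem : ∀ a, a ∈ (replicate (m + 1) v).flatten ↔ a ∈ v := by
    intro a
    simp [List.mem_flatten, List.mem_replicate]
  have hp : (replicate (m + 1) v).flatten.Pairwise (· ≤ ·) :=
    List.pairwise_of_forall_mem_list fun a ha b hb =>
      (hv a ((hmem a).1 ha) b ((hmem b).1 hb)).le
  simp only [List.pairwise_append, List.mem_append, hmem] at h ⊢
  exact ⟨⟨h.1.1, hp, h.1.2.2⟩, h.2⟩

lemma count_eq_zero_of_mem_right {u z : List α} (h : (u ++ z).Pairwise (· ≤ ·)) {c k : α}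
    (hc : c ∈ z) (hk : c < k) : u.count k = 0 :=
  List.count_eq_zero.2 fun hku => hk.not_ge ((List.pairwise_append.1 h).2.2 k hku c hc)

lemma count_eq_zero_of_mem_left {u z : List α} (h : (u ++ z).Pairwise (· ≤ ·)) {c k : α}
    (hc : c ∈ u) (hk : k < c) : z.count k = 0 :=
  List.count_eq_zero.2 fun hkz => hk.not_ge ((List.pairwise_append.1 h).2.2 c hc k hkz)

end Sorted

/-! ### Words with four blocks -/

/-- The word `0ᵃ1ᵇ2ᶜ3ᵈ`. -/
def fourBlocks (a b c d : ℕ) : List (Fin 4) :=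
  replicate a 0 ++ replicate b 1 ++ replicate c 2 ++ replicate d 3

/-- Forgets which block a letter belongs to: `0, 2 ↦ 0` and `1, 3 ↦ 1`. -/
def blockLetter : Fin 4 → Fin 2 := ![0, 1, 0, 1]

lemma map_fourBlocks (a b c d : ℕ) : (fourBlocks a b c d).map blockLetter =
    replicate a 0 ++ replicate b 1 ++ replicate c 0 ++ replicate d 1 := by
  simp [fourBlocks, blockLetter]

lemma count_fourBlocks (a b c d : ℕ) (k : Fin 4) :
    (fourBlocks a b c d).count k = ![a, b, c, d] k := by
  fin_cases k <;> simp [fourBlocks, List.count_replicate]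

lemma count_add_of_eq_fourBlocks {l v x y r : List (Fin 4)} {a b c d : ℕ}
    (h : l ++ v ++ x ++ y ++ r = fourBlocks a b c d) (k : Fin 4) :
    l.count k + v.count k + x.count k + y.count k + r.count k = ![a, b, c, d] k := by
  rw [← count_fourBlocks, ← h]
  simp only [List.count_append]

lemma pairwise_fourBlocks (a b c d : ℕ) : (fourBlocks a b c d).Pairwise (· ≤ ·) := by
  simp only [fourBlocks, List.pairwise_append, List.mem_append, List.mem_replicate,
    List.pairwise_replicate]
  refine ⟨⟨⟨by simp, by simp, ?_⟩, by simp, ?_⟩, by simp, ?_⟩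
  · rintro _ ⟨-, rfl⟩ _ ⟨-, rfl⟩; decide
  · rintro _ (⟨-, rfl⟩ | ⟨-, rfl⟩) _ ⟨-, rfl⟩ <;> decide
  · rintro _ ((⟨-, rfl⟩ | ⟨-, rfl⟩) | ⟨-, rfl⟩) _ ⟨-, rfl⟩ <;> decide

lemma eq_fourBlocks {w : List (Fin 4)} (h : w.Pairwise (· ≤ ·)) :
    w = fourBlocks (w.count 0) (w.count 1) (w.count 2) (w.count 3) := by
  refine List.Perm.eq_of_pairwise (fun a b _ _ => le_antisymm) h (pairwise_fourBlocks ..)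
    (List.perm_iff_count.2 fun k => ?_)
  rw [count_fourBlocks]
  fin_cases k <;> rfl

lemma length_eq_sum_count (w : List (Fin 4)) :
    w.length = w.count 0 + w.count 1 + w.count 2 + w.count 3 := by
  induction w with
  | nil => rfl
  | cons k w ih => fin_cases k <;> simp [ih] <;> omega

/-- The middle of the word lies in the second block, so each half contains one block of zeros. -/
lemma isAbelianSquare_fourBlocks_of_le {a b d : ℕ} (hdb : d ≤ b) (h : Even (b + d)) :
    IsAbelianSquare ((fourBlocks a b a d).map blockLetter) := by
  obtain ⟨k, hk⟩ := h
  refine ⟨replicate a 0 ++ replicate k 1, replicate (b - k) 1 ++ (replicate a 0 ++ replicate d 1),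
    ?_, ?_⟩
  · have hb : b = k + (b - k) := by omega
    conv_lhs => rw [map_fourBlocks, hb, List.replicate_add]
    simp only [List.append_assoc]
  · have hk' : k = b - k + d := by omega
    refine List.perm_iff_count.2 fun x => ?_
    fin_cases x <;> simp [List.count_replicate]; omega

/-- The middle of the word lies in the third block, so each half contains one block of ones. -/
lemma isAbelianSquare_fourBlocks_of_ge {a b c : ℕ} (hac : a ≤ c) (h : Even (a + c)) :
    IsAbelianSquare ((fourBlocks a b c b).map blockLetter) := by
  obtain ⟨k, hk⟩ := h
  refine ⟨replicate a 0 ++ (replicate b 1 ++ replicate (k - a) 0), replicate (c - (k - a)) 0 ++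
    replicate b 1, ?_, ?_⟩
  · have hb : c = (k - a) + (c - (k - a)) := by omega
    conv_lhs => rw [map_fourBlocks, hb, List.replicate_add]
    simp only [List.append_assoc]
  · refine List.perm_iff_count.2 fun x => ?_
    fin_cases x <;> simp [List.count_replicate]; omega

/-! ### Pumping against abelian squares -/

/-- If the four block lengths of `0ᵖ1ᵖ⁺ᴺ0ᵖ⁺ᴺ1ᵖ`, where `N = 2 * p!`, grow at constant rates
`i`, `k`, `j`, `l`, then an abelian square turns up, unless two blocks at distance two grow
together. -/
lemma exists_isAbelianSquare_fourBlocks {p i k j l : ℕ} (hi : i ≤ p) (hl : l ≤ p)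
    (hil : 0 < i ∨ 0 < l) (hij : 0 < i → j = 0) (hkl : 0 < l → k = 0) :
    ∃ m, IsAbelianSquare ((fourBlocks (p + m * i) (p + 2 * p.factorial + m * k)
      (p + 2 * p.factorial + m * j) (p + m * l)).map blockLetter) := by
  rcases le_or_gt l i with hle | hlt
  · -- The first block reaches `p + N` no later than the fourth, and then it is as long as the
    -- third one. The factor `2` in `N` makes the number of repetitions, hence the length, even.
    have hpos : 0 < i := by omega
    obtain ⟨m, hm⟩ := Nat.dvd_factorial hpos hi
    have hml : m * l ≤ m * i := Nat.mul_le_mul_left m hle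
    have hmi : 2 * m * i = 2 * p.factorial := by rw [hm]; ring
    refine ⟨2 * m, ?_⟩
    rw [hij hpos, hmi, mul_zero, add_zero]
    refine isAbelianSquare_fourBlocks_of_le (by rw [mul_assoc] at *; omega)
      ⟨p + p.factorial + m * k + m * l, by ring⟩
  · -- The fourth block reaches `p + N` first, and then it is as long as the second one.
    have hpos : 0 < l := by omega
    obtain ⟨m, hm⟩ := Nat.dvd_factorial hpos hl
    have hml : m * i ≤ m * l := Nat.mul_le_mul_left m hlt.le
    have hmi : 2 * m * l = 2 * p.factorial := by rw [hm]; ring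
    refine ⟨2 * m, ?_⟩
    rw [hkl hpos, hmi, mul_zero, add_zero]
    refine isAbelianSquare_fourBlocks_of_ge (by rw [mul_assoc] at *; omega)
      ⟨p + p.factorial + m * i + m * j, by ring⟩

/-- If pumping `v` and `y`, each a power of a single letter, never leads to an abelian square, and
the first or the last block of the word grows, then `v` and `y` lie in the first and third or in
the second and fourth blocks. -/
lemma mem_of_pump_nonAbelianSquares {p : ℕ} {l v x y r : List (Fin 4)}
    (hw : l ++ v ++ x ++ y ++ r = fourBlocks p (p + 2 * p.factorial) (p + 2 * p.factorial) p)
    (hv : ∀ a ∈ v, ∀ b ∈ v, a = b) (hy : ∀ a ∈ y, ∀ b ∈ y, a = b)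
    (hpump : ∀ m, (l ++ (replicate m v).flatten ++ x ++ (replicate m y).flatten ++ r).map
      blockLetter ∈ nonAbelianSquares)
    (hgrow : 0 < (v ++ y).count 0 ∨ 0 < (v ++ y).count 3) :
    0 ∈ v ∧ 2 ∈ y ∨ 1 ∈ v ∧ 3 ∈ y := by
  have hsort := hw ▸ pairwise_fourBlocks p (p + 2 * p.factorial) (p + 2 * p.factorial) p
  have h0 := count_add_of_eq_fourBlocks hw 0
  have h1 := count_add_of_eq_fourBlocks hw 1
  have h2 := count_add_of_eq_fourBlocks hw 2
  have h3 := count_add_of_eq_fourBlocks hw 3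
  simp at h0 h1 h2 h3
  have hpumped (m : ℕ) : l ++ (replicate (m + 1) v).flatten ++ x ++
      (replicate (m + 1) y).flatten ++ r = fourBlocks (p + m * (v ++ y).count 0)
        (p + 2 * p.factorial + m * (v ++ y).count 1) (p + 2 * p.factorial + m * (v ++ y).count 2)
        (p + m * (v ++ y).count 3) := by
    have hs := pairwise_le_repeat (m := m) hsort hy
    have hs : (l ++ v ++ (x ++ (replicate (m + 1) y).flatten ++ r)).Pairwise (· ≤ ·) := by
      simpa using hs
    have hs := pairwise_le_repeat (m := m) hs hv
    rw [← List.append_assoc, ← List.append_assoc] at hs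
    have hk (k : Fin 4) : (l ++ (replicate (m + 1) v).flatten ++ x ++
        (replicate (m + 1) y).flatten ++ r).count k =
          l.count k + v.count k + x.count k + y.count k + r.count k + m * (v ++ y).count k := by
      simp only [List.count_append, List.count_flatten, List.map_replicate, List.sum_replicate,
        smul_eq_mul]
      ring
    rw [eq_fourBlocks hs, hk, hk, hk, hk, h0, h1, h2, h3]
  have hprog : (0 < (v ++ y).count 0 ∧ 0 < (v ++ y).count 2) ∨
      (0 < (v ++ y).count 3 ∧ 0 < (v ++ y).count 1) := by
    by_contra hcon
    obtain ⟨m, hm⟩ := exists_isAbelianSquare_fourBlocks (p := p) (i := (v ++ y).count 0)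
      (k := (v ++ y).count 1) (j := (v ++ y).count 2) (l := (v ++ y).count 3)
      (by rw [List.count_append]; omega) (by rw [List.count_append]; omega) hgrow
      (by omega) (by omega)
    exact hpump (m + 1) (by rwa [hpumped])
  have hvy : ∀ a ∈ v, ∀ b ∈ y, a ≤ b := by
    simp only [List.pairwise_append, List.mem_append] at hsort
    exact fun a ha b hb => hsort.1.2.2 a (.inl (.inr ha)) b hb
  simp only [List.count_pos_iff, List.mem_append] at hprog
  rcases hprog with ⟨h | h, h' | h'⟩ | ⟨h | h, h' | h'⟩
  · exact absurd (hv _ h _ h') (by decide)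
  · exact .inl ⟨h, h'⟩
  · exact absurd (hvy _ h' _ h) (by decide)
  · exact absurd (hy _ h _ h') (by decide)
  · exact absurd (hv _ h _ h') (by decide)
  · exact absurd (hvy _ h _ h') (by decide)
  · exact .inr ⟨h', h⟩
  · exact absurd (hy _ h _ h') (by decide)

/-! ### Crossing occurrences -/

theorem mainTheorem1 : ¬ nonAbelianSquares.IsContextFree := by
  rintro ⟨g, hg⟩
  obtain ⟨B, hB1, hB⟩ : ∃ B, 1 ≤ B ∧ ∀ r ∈ g.rules, r.output.length ≤ B :=
    ⟨g.rules.sup (fun r => r.output.length) + 1, by omega, fun r hr =>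
      (Finset.le_sup (f := fun r => r.output.length) hr).trans (Nat.le_succ _)⟩
  let C := Option (Fin 4) × Option (Fin 4)
  obtain ⟨p, hp⟩ : ∃ p, B ^ (g.rules.card * Fintype.card C) < p := ⟨_, Nat.lt_succ_self _⟩
  have hpos : 0 < p.factorial := Nat.factorial_pos p
  set w := fourBlocks p (p + 2 * p.factorial) (p + 2 * p.factorial) p with hw
  have hwL : w.map blockLetter ∈ g.language := by
    rw [hg, hw, map_fourBlocks]
    rintro ⟨s, t, hst, hperm⟩
    have hlen := congrArg List.length hst
    have hsl := hperm.length_eq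
    simp only [List.length_append, List.length_replicate] at hlen
    rw [List.append_assoc] at hst
    obtain ⟨rfl, rfl⟩ := List.append_inj hst (by simp; omega)
    have := hperm.count_eq 0
    simp [List.count_replicate] at this
    omega
  have hparse : g.Parses blockLetter [.nonterminal g.initial] w := by
    refine .of_derives ?_
    rw [ContextFreeGrammar.mem_language_iff, List.map_map] at hwL
    exact hwL
  obtain ⟨S, hS⟩ := hparse.exists_isNodeSet hB
  -- The colour of an occurrence records the letters adjacent to it, so that between two nested
  -- occurrences of the same colour only powers of single letters are generated.
  have hpair : ∀ q : Fin 4, (q = 0 ∨ q = 3) → ∃ o ∈ S, ∃ v x y,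
      o.left ++ v ++ x ++ y ++ o.right = w ∧ 0 < (v ++ y).count q ∧
      (∀ a ∈ v, ∀ b ∈ v, a = b) ∧ (∀ a ∈ y, ∀ b ∈ y, a = b) ∧
      (0 ∈ v ∧ 2 ∈ y ∨ 1 ∈ v ∧ 3 ∈ y) := by
    intro q hq
    have hcq : w.countP (· == q) = p := by
      change w.count q = p
      rw [hw, count_fourBlocks]
      rcases hq with rfl | rfl <;> rfl
    obtain ⟨o, ho, o', ho', ⟨v, y, hl, hr, hm, hd⟩, hlt, hlabel, hκ⟩ :=
      hS.exists_pump hB1 (fun o => ((o.left.getLast?, o.right.head?) : C)) (· == q) (hcq ▸ hp)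
    have hwo : o.left ++ v ++ o'.mid ++ y ++ o.right = w := by
      simpa [hm] using hS.word_eq o ho
    have hsort := hwo ▸ hw ▸ pairwise_fourBlocks p (p + 2 * p.factorial) (p + 2 * p.factorial) p
    simp only [Prod.mk.injEq, hl, hr] at hκ
    have hv := eq_of_getLast?_eq
      (hsort.sublist (((List.sublist_append_left _ _).trans (List.sublist_append_left _ _)).trans
        (List.sublist_append_left _ _))) hκ.1
    have hy := eq_of_head?_eq (y := y) (r := o.right)
      (hsort.sublist (by rw [List.append_assoc]; exact List.sublist_append_right _ _)) hκ.2
    have hgrow : 0 < (v ++ y).count q := by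
      change o'.mid.count q < o.mid.count q at hlt
      rw [hm] at hlt
      simp only [List.count_append] at hlt ⊢
      omega
    refine ⟨o, ho, v, o'.mid, y, hwo, hgrow, hv, hy,
      mem_of_pump_nonAbelianSquares hwo hv hy ?_ ?_⟩
    · exact fun m => hg ▸ hS.pump_mem_language ho ho' hlabel hd m
    · rcases hq with rfl | rfl
      · exact .inl hgrow
      · exact .inr hgrow
  obtain ⟨o₁, ho₁, v₁, x₁, y₁, hw₁, hc₁, hv₁, hy₁, h₁⟩ := hpair 0 (.inl rfl)
  obtain ⟨o₂, ho₂, v₂, x₂, y₂, hw₂, hc₂, hv₂, hy₂, h₂⟩ := hpair 3 (.inr rfl)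
  replace h₁ : 0 ∈ v₁ ∧ 2 ∈ y₁ := by
    refine h₁.resolve_right fun h => ?_
    rcases List.mem_append.1 (List.count_pos_iff.1 hc₁) with h' | h'
    · exact absurd (hv₁ _ h' _ h.1) (by decide)
    · exact absurd (hy₁ _ h' _ h.2) (by decide)
  replace h₂ : 1 ∈ v₂ ∧ 3 ∈ y₂ := by
    refine h₂.resolve_left fun h => ?_
    rcases List.mem_append.1 (List.count_pos_iff.1 hc₂) with h' | h'
    · exact absurd (hv₂ _ h' _ h.1) (by decide)
    · exact absurd (hy₂ _ h' _ h.2) (by decide)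
  -- The outer node of the first pair starts in the first block and ends in the third one; that of
  -- the second pair starts in the second block and ends in the fourth one. So they cross.
  have hsort : w.Pairwise (· ≤ ·) := pairwise_fourBlocks ..
  have hlen₁ : o₁.left.length < p := by
    have hs : (o₁.left ++ (v₁ ++ x₁ ++ y₁ ++ o₁.right)).Pairwise (· ≤ ·) := by
      simpa [← hw₁] using hsort
    have h0 : (0 : Fin 4) ∈ v₁ ++ x₁ ++ y₁ ++ o₁.right := by simp [h₁.1]
    have := List.count_pos_iff.2 h₁.1
    have hc := count_add_of_eq_fourBlocks hw₁ 0
    simp at hc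
    rw [length_eq_sum_count, count_eq_zero_of_mem_right hs h0 (k := 1) (by decide),
      count_eq_zero_of_mem_right hs h0 (k := 2) (by decide),
      count_eq_zero_of_mem_right hs h0 (k := 3) (by decide)]
    omega
  have hlen₂ : o₂.right.length < p := by
    have hs : (o₂.left ++ v₂ ++ x₂ ++ y₂ ++ o₂.right).Pairwise (· ≤ ·) := hw₂ ▸ hsort
    have h3 : (3 : Fin 4) ∈ o₂.left ++ v₂ ++ x₂ ++ y₂ := by simp [h₂.2]
    have := List.count_pos_iff.2 h₂.2
    have hc := count_add_of_eq_fourBlocks hw₂ 3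
    simp at hc
    rw [length_eq_sum_count, count_eq_zero_of_mem_left hs h3 (k := 0) (by decide),
      count_eq_zero_of_mem_left hs h3 (k := 1) (by decide),
      count_eq_zero_of_mem_left hs h3 (k := 2) (by decide)]
    omega
  have hright₁ : p ≤ o₁.right.length ∧ o₁.right.length ≤ p + (p + 2 * p.factorial) := by
    have hs : (o₁.left ++ v₁ ++ x₁ ++ y₁ ++ o₁.right).Pairwise (· ≤ ·) := hw₁ ▸ hsort
    have hs' : (o₁.left ++ v₁ ++ x₁ ++ (y₁ ++ o₁.right)).Pairwise (· ≤ ·) := by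
      simpa [← hw₁] using hsort
    have h2 : (2 : Fin 4) ∈ o₁.left ++ v₁ ++ x₁ ++ y₁ := by simp [h₁.2]
    have h3 := count_eq_zero_of_mem_right hs' (List.mem_append_left _ h₁.2) (k := 3) (by decide)
    have h3' : y₁.count 3 = 0 :=
      List.count_eq_zero.2 fun h => absurd (hy₁ _ h _ h₁.2) (by decide)
    have hc2 := count_add_of_eq_fourBlocks hw₁ 2
    have hc3 := count_add_of_eq_fourBlocks hw₁ 3
    simp only [List.count_append] at h3
    simp at hc2 hc3
    rw [length_eq_sum_count, count_eq_zero_of_mem_left hs h2 (k := 0) (by decide),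
      count_eq_zero_of_mem_left hs h2 (k := 1) (by decide)]
    omega
  have hleft₂ : p ≤ o₂.left.length ∧ o₂.left.length < p + (p + 2 * p.factorial) := by
    have hs : (o₂.left ++ (v₂ ++ x₂ ++ y₂ ++ o₂.right)).Pairwise (· ≤ ·) := by
      simpa [← hw₂] using hsort
    have hs' : (o₂.left ++ v₂ ++ (x₂ ++ y₂ ++ o₂.right)).Pairwise (· ≤ ·) := by
      simpa [← hw₂] using hsort
    have h1 : (1 : Fin 4) ∈ v₂ ++ x₂ ++ y₂ ++ o₂.right := by simp [h₂.1]
    have h0 := count_eq_zero_of_mem_left hs' (List.mem_append_right _ h₂.1) (k := 0) (by decide)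
    have h0' : v₂.count 0 = 0 :=
      List.count_eq_zero.2 fun h => absurd (hv₂ _ h _ h₂.1) (by decide)
    have hpos := List.count_pos_iff.2 h₂.1
    have hc0 := count_add_of_eq_fourBlocks hw₂ 0
    have hc1 := count_add_of_eq_fourBlocks hw₂ 1
    simp only [List.count_append] at h0
    simp at hc0 hc1
    rw [length_eq_sum_count, count_eq_zero_of_mem_right hs h1 (k := 2) (by decide),
      count_eq_zero_of_mem_right hs h1 (k := 3) (by decide)]
    omega
  have hwlen : w.length = p + (p + 2 * p.factorial) + (p + 2 * p.factorial) + p := by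
    simp only [hw, fourBlocks, List.length_append, List.length_replicate]
  have := hS.not_crossing o₁ ho₁ o₂ ho₂ (by omega) (by omega)
  omega
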